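/- A straight-line program (SLP) over $\mathbb{Q}$ in given variables is a finite sequence of instructions, each of which performs one operation $+$, $-$ or $\times$ on constants of $\mathbb{Q}$, variables, and results of earlier instructions; its size is the number of its instructions, and it computes the results of its instructions (as well as constants and variables, at no cost). Let $\omega$ be the matrix-multiplication exponent over $\mathbb{Q}$, i.e. the infimum of the real numbers $\tau$ such that all entries of the product of two $m\times m$ matrices can be computed by one SLP of size $O(m^\tau)$. Proposition (SLP size of minors). There are a real constant $C$ and an integer $e\ge 0$ such that the following holds. Let $n,s,d,i,L\ge 0$ be integers with $d\le n$, let $f,f_1,\dots,f_s\in\mathbb{Q}[X_1,\dots,X_n]$ each be computed by an SLP of size at most $L$, and let $A\in\mathrm{GL}_n(\mathbb{Q})$. For $g\in\mathbb{Q}[X_1,\dots,X_n]$ write $g^A(X)=g(AX)$, and let $\mathrm{jac}([f^A,F^A],i+1)$ be the $(s+1)\times(n-i)$ Jacobian matrix of $(f^A,f_1^A,\dots,f_s^A)$ with respect to the variables $X_{i+1},\dots,X_n$ (it has no columns if $i\ge n$). Then every minor of size $n-d+1$ of $\mathrm{jac}([f^A,F^A],i+1)$ is computed by an SLP of size at most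 $$C\,a\,\bigl(\log(2+a)\bigr)^{e},\qquad a=(n-d+1)^{\omega/2+2}\,(L+n^2),$$ that is, of size $\widetilde{O}\bigl((n-d+1)^{\omega/2+2}(L+n^2)\bigr)$. In particular this applies when $d$ is the dimension of the variety $V(f_1,\dots,f_s)$. -/

import Mathlib

/-- The arithmetic operations allowed in a (division-free) straight-line program. -/
inductive SLPOp : Type
  | add
  | sub
  | mul

/-- The polynomial operation denoted by an operation symbol. -/
def SLPOp.apply {R : Type*} [CommRing R] : SLPOp → R → R → R
  | .add, a, b => a + b
  | .sub, a, b => a - b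
  | .mul, a, b => a * b

/-- An operand of an instruction that is preceded by `m` instructions: a constant of the ground
ring, an input variable, or the result of one of the `m` previous instructions. -/
inductive SLPOperand (K σ : Type*) (m : ℕ) : Type _
  | const (c : K) : SLPOperand K σ m
  | var (x : σ) : SLPOperand K σ m
  | reg (i : Fin m) : SLPOperand K σ m

/-- The value of an operand, given the values of the previous instructions. -/
noncomputable def SLPOperand.eval {K σ : Type*} [CommRing K] {m : ℕ}
    (v : Fin m → MvPolynomial σ K) : SLPOperand K σ m → MvPolynomial σ K
  | .const c => MvPolynomial.C c
  | .var x => MvPolynomial.X x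
  | .reg i => v i

/-- `SLP K σ m` is the type of straight-line programs over `K` in the variables `σ` that consist of
exactly `m` instructions. Each instruction performs one operation `+`, `-` or `×` on constants,
variables and results of earlier instructions. The size of the program is `m`. -/
inductive SLP (K σ : Type*) : ℕ → Type _
  | nil : SLP K σ 0
  | snoc {m : ℕ} (P : SLP K σ m) (op : SLPOp) (a b : SLPOperand K σ m) : SLP K σ (m + 1)

/-- The polynomials computed by the successive instructions of a straight-line program. -/
noncomputable def SLP.values {K σ : Type*} [CommRing K] :
    {m : ℕ} → SLP K σ m → Fin m → MvPolynomial σ K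
  | _, .nil => Fin.elim0
  | _, .snoc P op a b =>
      Fin.snoc (α := fun _ => MvPolynomial σ K) P.values
        (op.apply (a.eval P.values) (b.eval P.values))

/-- The program `P` computes the polynomial `p`: `p` is the result of one of its instructions (or is
a constant or a variable, which costs nothing). -/
def SLP.Computes {K σ : Type*} [CommRing K] {m : ℕ} (P : SLP K σ m) (p : MvPolynomial σ K) : Prop :=
  ∃ o : SLPOperand K σ m, o.eval P.values = p

/-- The polynomial `p` is represented by a straight-line program of size at most `L`. -/
def HasSLPOfSize {K σ : Type*} [CommRing K] (p : MvPolynomial σ K) (L : ℕ) : Prop :=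
  ∃ m ≤ L, ∃ P : SLP K σ m, P.Computes p

/-- The `(i, j)` entry of the product of two generic `m × m` matrices, a polynomial in the `2 m²`
entries of the two factors. -/
noncomputable def genericMatMulEntry (K : Type*) [CommRing K] (m : ℕ) (i j : Fin m) :
    MvPolynomial ((Fin m × Fin m) ⊕ (Fin m × Fin m)) K :=
  ∑ k : Fin m, MvPolynomial.X (Sum.inl (i, k)) * MvPolynomial.X (Sum.inr (k, j))

/-- The matrix-multiplication exponent `ω` over `K`: the infimum of the real numbers `τ` such that
all the entries of the product of two `m × m` matrices can be computed by one straight-line program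
of size `O(m ^ τ)`. -/
noncomputable def matMulExponent (K : Type*) [CommRing K] : ℝ :=
  sInf {τ : ℝ | ∃ C : ℝ, ∀ m : ℕ, 1 ≤ m →
    ∃ (N : ℕ) (P : SLP K ((Fin m × Fin m) ⊕ (Fin m × Fin m)) N),
      (∀ i j : Fin m, P.Computes (genericMatMulEntry K m i j)) ∧ (N : ℝ) ≤ C * (m : ℝ) ^ τ}

/-- The polynomial `f^A(X) = f(A X)`. -/
noncomputable def changeCoords {n : ℕ} (A : Matrix.GeneralLinearGroup (Fin n) ℚ)
    (f : MvPolynomial (Fin n) ℚ) : MvPolynomial (Fin n) ℚ :=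
  MvPolynomial.bind₁
    (fun i => ∑ j : Fin n, MvPolynomial.C ((A : Matrix (Fin n) (Fin n) ℚ) i j) * MvPolynomial.X j) f

/-- The truncated Jacobian matrix `jac(G, k)` of a family `G` of `p` polynomials with respect to the
variables `X_k, …, X_n`. The variables `X_1, …, X_n` are indexed by `Fin n`, so that `X_k` has
index `k - 1`. -/
noncomputable def truncJacobian {n p : ℕ} (G : Fin p → MvPolynomial (Fin n) ℚ) (k : ℕ) :
    Matrix (Fin p) {j : Fin n // k ≤ (j : ℕ) + 1} (MvPolynomial (Fin n) ℚ) :=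
  Matrix.of fun a j => MvPolynomial.pderiv j.1 (G a)

/-- `q` is a minor of size `r` of the matrix `M`. -/
def IsMinor {ι κ R : Type*} [Preorder ι] [Preorder κ] [CommRing R] (M : Matrix ι κ R) (r : ℕ)
    (q : R) : Prop :=
  ∃ (rows : Fin r ↪o ι) (cols : Fin r ↪o κ), q = (M.submatrix rows cols).det

/-! Put r = n - d + 1. Since ω ≥ 0, the factor r^(ω/2+2) is at least r², so it suffices to find
programs of size O(r²(L + n²)); elementary algorithms reach this without fast matrix multiplication
or a logarithm.

The n linear forms of AX cost 2n² operations. Running a program of f on them, with r derivatives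
carried along (`SLP.computable_jets`), costs L(1 + 3r) more, so r rows of r entries cost O(rn² +
r²L). The determinant of these entries takes O(r⁴) operations by the Faddeev–LeVerrier recursion
(`SLPComputable.det`), whose only divisions are by nonzero integers, hence multiplications by
rational constants. A minor with r columns exists only if r ≤ n, so r⁴ ≤ r²n².

Costs are counted on sets of ring elements (`SLPComputable`), which avoids register bookkeeping;
`SLPReach.exists_slp` returns to actual programs. -/

open Polynomial in
/-- The derivative of the characteristic polynomial is the trace of the adjugate of the
characteristic matrix. -/
theorem Matrix.derivative_charpoly {ι R : Type*} [Fintype ι] [DecidableEq ι] [CommRing R]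
    (M : Matrix ι ι R) :
    derivative M.charpoly = M.charmatrix.adjugate.trace := by
  have hd : ∀ i j, derivative (M.charmatrix i j) = if i = j then 1 else 0 := by
    intro i j
    by_cases h : i = j
    · subst h; simp [Matrix.charmatrix_apply_eq]
    · simp [h]
  simp only [Matrix.charpoly, Matrix.trace, Matrix.diag, Matrix.adjugate_apply]
  simp only [Matrix.det_apply', derivative_sum, derivative_mul, derivative_intCast, zero_mul,
    zero_add, derivative_prod_finset]
  rw [Finset.sum_comm]
  refine Finset.sum_congr rfl fun σ _ => ?_
  rw [Finset.mul_sum]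
  -- In the term of σ the factor from column i lies in row σ i, so differentiating that factor
  -- corresponds to replacing row σ i.
  conv_rhs => rw [← Equiv.sum_comp σ]
  refine Finset.sum_congr rfl fun i _ => ?_
  congr 1
  rw [← Finset.mul_prod_erase _ _ (Finset.mem_univ i), mul_comm, hd]
  congr 1
  · simp [Pi.single_apply, eq_comm]
  · refine Finset.prod_congr rfl fun j hj => ?_
    have : j ≠ i := Finset.ne_of_mem_erase hj
    simp [Matrix.updateRow_apply, σ.injective.ne this]

/-- The coefficient of `X ^ k` in the adjugate of the characteristic matrix. -/
noncomputable def Matrix.adjugateCoeff {ι R : Type*} [Fintype ι] [DecidableEq ι] [CommRing R]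
    (M : Matrix ι ι R) (k : ℕ) : Matrix ι ι R :=
  (matPolyEquiv M.charmatrix.adjugate).coeff k

/-! ### The Faddeev–LeVerrier recursion -/

section FaddeevLeVerrier

open Polynomial

variable {ι R : Type*} [Fintype ι] [DecidableEq ι] [CommRing R] (M : Matrix ι ι R)

/-- The adjugate identity for the characteristic matrix, read over polynomials with matrix
coefficients. Comparing coefficients yields the recursion. -/
theorem Matrix.X_sub_C_mul_matPolyEquiv_adjugate :
    (X - C M) * matPolyEquiv M.charmatrix.adjugate =
      M.charpoly.map (algebraMap R (Matrix ι ι R)) := by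
  rw [← matPolyEquiv_charmatrix, ← map_mul, Matrix.mul_adjugate]
  exact matPolyEquiv_smul_one _

theorem Matrix.adjugateCoeff_rec (k : ℕ) :
    M.adjugateCoeff k =
      M * M.adjugateCoeff (k + 1) + M.charpoly.coeff (k + 1) • (1 : Matrix ι ι R) := by
  have h := congrArg (fun p => p.coeff (k + 1)) M.X_sub_C_mul_matPolyEquiv_adjugate
  simp only [sub_mul, coeff_sub, coeff_X_mul, coeff_C_mul, coeff_map] at h
  rw [Algebra.algebraMap_eq_smul_one] at h
  rw [← h, Matrix.adjugateCoeff, Matrix.adjugateCoeff]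
  abel

theorem Matrix.mul_adjugateCoeff_zero :
    M * M.adjugateCoeff 0 = - (M.charpoly.coeff 0 • (1 : Matrix ι ι R)) := by
  have h := congrArg (fun p => p.coeff 0) M.X_sub_C_mul_matPolyEquiv_adjugate
  simp only [sub_mul, coeff_sub, mul_coeff_zero, coeff_X_zero, zero_mul, coeff_C_zero,
    coeff_map, zero_sub] at h
  rw [Algebra.algebraMap_eq_smul_one] at h
  rw [← h, Matrix.adjugateCoeff, neg_neg]

/-- Multiplying by the monic factor X - M raises the degree by exactly one, and the product has
degree at most the size of M. -/
theorem Matrix.adjugateCoeff_eq_zero [Nontrivial R] {k : ℕ} (hk : Fintype.card ι ≤ k) :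
    M.adjugateCoeff k = 0 := by
  cases isEmpty_or_nonempty ι
  · exact Subsingleton.elim _ _
  rw [Matrix.adjugateCoeff]
  by_cases h0 : matPolyEquiv M.charmatrix.adjugate = 0
  · simp [h0]
  apply coeff_eq_zero_of_natDegree_lt
  have h1 := (monic_X_sub_C M).natDegree_mul' h0
  have h2 : natDegree (M.charpoly.map (algebraMap R (Matrix ι ι R))) ≤ Fintype.card ι :=
    natDegree_map_le.trans M.charpoly_natDegree_eq_dim.le
  rw [M.X_sub_C_mul_matPolyEquiv_adjugate, natDegree_X_sub_C] at h1
  omega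

theorem Matrix.trace_adjugateCoeff (k : ℕ) :
    (M.adjugateCoeff k).trace = M.charpoly.coeff (k + 1) * (k + 1) := by
  rw [← coeff_derivative, M.derivative_charpoly]
  simp [Matrix.trace, Matrix.adjugateCoeff, matPolyEquiv_coeff_apply]

/-- Obtained by taking traces in the recursion and using the derivative formula. It determines the
coefficient of index k once the integer on the left is invertible. -/
theorem Matrix.trace_mul_adjugateCoeff (k : ℕ) :
    ((Fintype.card ι : R) - k) * M.charpoly.coeff k = - (M * M.adjugateCoeff k).trace := by
  cases k with
  | zero =>
    rw [M.mul_adjugateCoeff_zero]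
    simp [Matrix.trace_neg, Matrix.trace_smul, mul_comm]
  | succ k =>
    have h := congrArg Matrix.trace (M.adjugateCoeff_rec k)
    rw [M.trace_adjugateCoeff, Matrix.trace_add, Matrix.trace_smul, Matrix.trace_one,
      smul_eq_mul] at h
    push_cast
    linear_combination -h

end FaddeevLeVerrier

/-! ### Operation counts on sets of ring elements -/

/-- `SLPReach S m U`: starting from the elements of `S`, the results of `m` successive operations
enlarge `S` to `U`. -/
inductive SLPReach {R : Type*} [CommRing R] (S : Set R) : ℕ → Set R → Prop
  | refl : SLPReach S 0 S
  | step {m : ℕ} {U : Set R} (op : SLPOp) {x y : R} (h : SLPReach S m U) (hx : x ∈ U)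
      (hy : y ∈ U) : SLPReach S (m + 1) (insert (op.apply x y) U)

/-- All elements of `T` can be computed from those of `S` with at most `k` operations. -/
def SLPComputable {R : Type*} [CommRing R] (S : Set R) (k : ℕ) (T : Set R) : Prop :=
  ∃ m ≤ k, ∃ U, SLPReach S m U ∧ T ⊆ U

section SLPComputable

variable {R : Type*} [CommRing R] {S S' T T' U V : Set R} {k l m : ℕ}

theorem SLPReach.subset (h : SLPReach S m U) : S ⊆ U := by
  induction h with
  | refl => exact subset_rfl
  | step op _ _ _ ih => exact ih.trans (Set.subset_insert _ _)

theorem SLPReach.trans (h : SLPReach S m U) (h' : SLPReach U l V) : SLPReach S (m + l) V := by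
  induction h' with
  | refl => exact h
  | step op _ hx hy ih => exact ih.step op hx hy

theorem SLPReach.union (h : SLPReach S m U) (hS : S ⊆ S') : SLPReach S' m (S' ∪ U) := by
  induction h with
  | refl => rw [Set.union_eq_self_of_subset_right hS]; exact .refl
  | step op _ hx hy ih =>
    rw [Set.union_insert]
    exact ih.step op (Or.inr hx) (Or.inr hy)

theorem SLPComputable.of_subset (h : T ⊆ S) : SLPComputable S k T :=
  ⟨0, k.zero_le, S, .refl, h⟩

theorem SLPComputable.mono (h : SLPComputable S k T) (hS : S ⊆ S') (hk : k ≤ l) (hT : T' ⊆ T) :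
    SLPComputable S' l T' := by
  obtain ⟨m, hm, U, hU, hTU⟩ := h
  exact ⟨m, hm.trans hk, _, hU.union hS, (hT.trans hTU).trans Set.subset_union_right⟩

/-- Keeping T in the conclusion leaves intermediate results available to later stages. -/
theorem SLPComputable.trans (h : SLPComputable S k T) (h' : SLPComputable (S ∪ T) l U) :
    SLPComputable S (k + l) (T ∪ U) := by
  obtain ⟨m, hm, V, hV, hTV⟩ := h
  obtain ⟨m', hm', W, hW, hUW⟩ := h'
  refine ⟨m + m', add_le_add hm hm', _,
    hV.trans (hW.union (Set.union_subset hV.subset hTV)), Set.union_subset ?_ ?_⟩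
  · exact hTV.trans Set.subset_union_left
  · exact hUW.trans Set.subset_union_right

theorem SLPComputable.union (h : SLPComputable S k T) (h' : SLPComputable S l U) :
    SLPComputable S (k + l) (T ∪ U) :=
  h.trans (h'.mono Set.subset_union_left le_rfl subset_rfl)

theorem SLPComputable.biUnion {ι : Type*} (s : Finset ι) {T : ι → Set R}
    (h : ∀ i ∈ s, SLPComputable S k (T i)) : SLPComputable S (s.card * k) (⋃ i ∈ s, T i) := by
  classical
  induction s using Finset.induction_on with
  | empty => exact .of_subset (by simp)
  | insert a s ha ih =>
    rw [Finset.card_insert_of_notMem ha, Finset.set_biUnion_insert, add_mul, one_mul, add_comm]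
    exact (h a (Finset.mem_insert_self a s)).union
      (ih fun i hi => h i (Finset.mem_insert_of_mem hi))

theorem SLPComputable.iUnion {ι : Type*} [Fintype ι] {T : ι → Set R}
    (h : ∀ i, SLPComputable S k (T i)) : SLPComputable S (Fintype.card ι * k) (⋃ i, T i) := by
  have := SLPComputable.biUnion Finset.univ fun i _ => h i
  simpa using this

theorem SLPComputable.op (op : SLPOp) {x y : R} (hx : x ∈ S) (hy : y ∈ S) :
    SLPComputable S 1 {op.apply x y} :=
  ⟨1, le_rfl, _, SLPReach.refl.step op hx hy, by simp⟩

theorem SLPComputable.add {x y : R} (hx : x ∈ S) (hy : y ∈ S) : SLPComputable S 1 {x + y} :=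
  .op .add hx hy

theorem SLPComputable.sub {x y : R} (hx : x ∈ S) (hy : y ∈ S) : SLPComputable S 1 {x - y} :=
  .op .sub hx hy

theorem SLPComputable.mul {x y : R} (hx : x ∈ S) (hy : y ∈ S) : SLPComputable S 1 {x * y} :=
  .op .mul hx hy

theorem SLPComputable.trans_right (h : SLPComputable S k T) (h' : SLPComputable (S ∪ T) l U) :
    SLPComputable S (k + l) U :=
  (h.trans h').mono subset_rfl le_rfl Set.subset_union_right

theorem SLPComputable.sum {ι : Type*} (s : Finset ι) {g : ι → R} (h0 : 0 ∈ S)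
    (h : ∀ i ∈ s, g i ∈ S) : SLPComputable S s.card {∑ i ∈ s, g i} := by
  classical
  induction s using Finset.induction_on with
  | empty => exact .of_subset (by simpa using h0)
  | insert a s ha ih =>
    rw [Finset.card_insert_of_notMem ha, Finset.sum_insert ha]
    exact (ih fun i hi => h i (Finset.mem_insert_of_mem hi)).trans_right
      (.add (Or.inl (h a (Finset.mem_insert_self a s))) (Or.inr rfl))

theorem SLPComputable.sum_mul {ι : Type*} [Fintype ι] {g g' : ι → R} (h0 : 0 ∈ S)
    (h : ∀ i, g i ∈ S) (h' : ∀ i, g' i ∈ S) :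
    SLPComputable S (2 * Fintype.card ι) {∑ i, g i * g' i} := by
  have h1 : SLPComputable S (Fintype.card ι * 1) (⋃ i, {g i * g' i}) :=
    .iUnion fun i => .mul (h i) (h' i)
  refine (h1.trans_right (.sum Finset.univ (Or.inl h0) fun i _ => Or.inr ?_)).mono subset_rfl
    (by simp [two_mul]) subset_rfl
  exact Set.mem_iUnion.2 ⟨i, rfl⟩

end SLPComputable

/-! ### Cost of the determinant -/

section Matrix

variable {R : Type*} [CommRing R] {r : ℕ} {S : Set R}

/-- The set of entries of a matrix. -/
def Matrix.entries {ι κ R : Type*} (M : Matrix ι κ R) : Set R :=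
  Set.range fun p : ι × κ => M p.1 p.2

theorem Matrix.mem_entries {ι κ R : Type*} (M : Matrix ι κ R) (i : ι) (j : κ) :
    M i j ∈ M.entries :=
  ⟨(i, j), rfl⟩

theorem SLPComputable.matrix_mul {M N : Matrix (Fin r) (Fin r) R} (h0 : 0 ∈ S)
    (hM : M.entries ⊆ S) (hN : N.entries ⊆ S) :
    SLPComputable S (2 * r ^ 3) (M * N).entries := by
  have h : ∀ p : Fin r × Fin r, SLPComputable S (2 * r) {(M * N) p.1 p.2} := fun p => by
    have := SLPComputable.sum_mul (S := S) (g := fun k => M p.1 k) (g' := fun k => N k p.2) h0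
      (fun k => hM (M.mem_entries _ _)) (fun k => hN (N.mem_entries _ _))
    rwa [Fintype.card_fin, ← Matrix.mul_apply] at this
  refine (SLPComputable.iUnion h).mono subset_rfl (le_of_eq ?_) ?_
  · simp only [Fintype.card_prod, Fintype.card_fin]; ring
  · rintro _ ⟨p, rfl⟩
    exact Set.mem_iUnion.2 ⟨p, rfl⟩

variable [Algebra ℚ R]

/-- One step of the Faddeev–LeVerrier recursion. -/
theorem SLPComputable.charpoly_coeff {M : Matrix (Fin r) (Fin r) R}
    (hK : Set.range (algebraMap ℚ R) ⊆ S) (hM : M.entries ⊆ S) {k : ℕ} (hk : k < r)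
    (hB : (M.adjugateCoeff k).entries ⊆ S) :
    SLPComputable S (2 * r ^ 3 + (r + 1))
      ((M * M.adjugateCoeff k).entries ∪ {M.charpoly.coeff k}) := by
  have h0 : (0 : R) ∈ S := hK ⟨0, map_zero _⟩
  refine (SLPComputable.matrix_mul h0 hM hB).trans ?_
  have htr := SLPComputable.sum (S := S ∪ (M * M.adjugateCoeff k).entries) Finset.univ
    (g := fun i : Fin r => (M * M.adjugateCoeff k) i i) (Or.inl h0)
    fun i _ => Or.inr (Matrix.mem_entries _ _ _)
  rw [Finset.card_univ, Fintype.card_fin] at htr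
  refine htr.trans_right ?_
  -- Since k < r, dividing by r - k is a single multiplication by a rational constant.
  have hc : M.charpoly.coeff k = algebraMap ℚ R (-((r : ℚ) - k)⁻¹) *
      ∑ i : Fin r, (M * M.adjugateCoeff k) i i := by
    have h := M.trace_mul_adjugateCoeff k
    have hne : (r : ℚ) - k ≠ 0 := sub_ne_zero.2 (by exact_mod_cast hk.ne')
    have h1 : algebraMap ℚ R ((r : ℚ) - k)⁻¹ * ((r : R) - k) = 1 := by
      have : (r : R) - k = algebraMap ℚ R ((r : ℚ) - k) := by simp
      rw [this, ← map_mul, inv_mul_cancel₀ hne, map_one]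
    rw [Fintype.card_fin, Matrix.trace] at h
    simp only [Matrix.diag] at h
    rw [map_neg]
    linear_combination (-M.charpoly.coeff k) * h1 + algebraMap ℚ R ((r : ℚ) - k)⁻¹ * h
  rw [hc]
  exact .mul (Or.inl (Or.inl (hK ⟨_, rfl⟩))) (Or.inr rfl)

/-- The recursion descends from index r - 1, where the coefficient is the identity matrix and costs
nothing. -/
theorem SLPComputable.adjugateCoeff [Nontrivial R] {M : Matrix (Fin r) (Fin r) R}
    (hK : Set.range (algebraMap ℚ R) ⊆ S) (hM : M.entries ⊆ S) (j : ℕ) (hj : j < r) :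
    SLPComputable S (j * (2 * r ^ 3 + (r + 1) + r)) (M.adjugateCoeff (r - 1 - j)).entries := by
  induction j with
  | zero =>
    refine .of_subset ?_
    have h1 : M.adjugateCoeff (r - 1 - 0) = 1 := by
      rw [M.adjugateCoeff_rec, M.adjugateCoeff_eq_zero (by simp; omega)]
      have := M.charpoly_monic.coeff_natDegree
      rw [M.charpoly_natDegree_eq_dim, Fintype.card_fin] at this
      rw [show r - 1 - 0 + 1 = r by omega, this]
      simp
    rw [h1]
    rintro _ ⟨p, rfl⟩
    refine hK ⟨if p.1 = p.2 then 1 else 0, ?_⟩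
    simp [Matrix.one_apply, apply_ite]
  | succ j ih =>
    set k := r - 1 - j with hk
    rw [show r - 1 - (j + 1) = k - 1 by omega, M.adjugateCoeff_rec,
      show k - 1 + 1 = k by omega, add_mul, one_mul]
    refine (ih (by omega)).trans_right ?_
    refine (SLPComputable.charpoly_coeff (k := k) (hK.trans Set.subset_union_left)
      (hM.trans Set.subset_union_left) (by omega) Set.subset_union_right).trans_right ?_
    set S' := S ∪ (M.adjugateCoeff k).entries ∪
      ((M * M.adjugateCoeff k).entries ∪ {M.charpoly.coeff k}) with hS'
    -- Adding a scalar matrix changes only the diagonal, so r additions suffice.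
    have hd : ∀ i : Fin r,
        SLPComputable S' 1 {(M * M.adjugateCoeff k) i i + M.charpoly.coeff k} := fun i =>
      .add (Or.inr (Or.inl (Matrix.mem_entries _ _ _))) (Or.inr (Or.inr rfl))
    refine ((SLPComputable.of_subset (k := 0) (subset_refl S')).union
      (SLPComputable.iUnion hd)).mono subset_rfl (by simp) ?_
    rintro _ ⟨⟨i, i'⟩, rfl⟩
    by_cases hi : i = i'
    · subst hi
      exact Or.inr (Set.mem_iUnion.2 ⟨i, by simp⟩)
    · refine Or.inl (Or.inr (Or.inl ⟨(i, i'), ?_⟩))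
      simp [Matrix.one_apply_ne hi]

/-- For r > 0, r - 1 recursion steps, one more coefficient step for the constant term of the
characteristic polynomial, and one multiplication by the sign. -/
theorem SLPComputable.det [Nontrivial R] {M : Matrix (Fin r) (Fin r) R}
    (hK : Set.range (algebraMap ℚ R) ⊆ S) (hM : M.entries ⊆ S) :
    SLPComputable S (5 * r ^ 4 + 1) {M.det} := by
  rcases Nat.eq_zero_or_pos r with rfl | hr
  · refine .of_subset ?_
    rw [Matrix.det_fin_zero, Set.singleton_subset_iff]
    exact hK ⟨1, map_one _⟩
  have hB := SLPComputable.adjugateCoeff hK hM (r - 1) (by omega)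
  rw [Nat.sub_self] at hB
  have hc := hB.trans_right (SLPComputable.charpoly_coeff (k := 0) (hK.trans Set.subset_union_left)
    (hM.trans Set.subset_union_left) hr Set.subset_union_right)
  refine (hc.trans_right (U := {M.det}) (l := 1) ?_).mono subset_rfl ?_ subset_rfl
  · have : M.det = algebraMap ℚ R ((-1) ^ r) * M.charpoly.coeff 0 := by
      rw [M.det_eq_sign_charpoly_coeff]; simp
    rw [this]
    exact .mul (Or.inl (hK ⟨_, rfl⟩)) (Or.inr (Or.inr rfl))
  · obtain ⟨t, rfl⟩ : ∃ t, r = t + 1 := ⟨r - 1, by omega⟩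
    rw [Nat.add_sub_cancel]
    ring_nf
    nlinarith [Nat.zero_le t, Nat.zero_le (t ^ 2), Nat.zero_le (t ^ 3), Nat.zero_le (t ^ 4)]

end Matrix

/-! ### Back to straight-line programs -/

/-- The constants and the variables, from which straight-line programs start. -/
def slpInputs (K σ : Type*) [CommRing K] : Set (MvPolynomial σ K) :=
  Set.range MvPolynomial.C ∪ Set.range MvPolynomial.X

/-- The operand `o`, read after one further instruction. -/
def SLPOperand.castSucc {K σ : Type*} {m : ℕ} : SLPOperand K σ m → SLPOperand K σ (m + 1)
  | .const c => .const c
  | .var x => .var x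
  | .reg i => .reg i.castSucc

theorem SLPOperand.eval_castSucc {K σ : Type*} [CommRing K] {m : ℕ}
    (v : Fin m → MvPolynomial σ K) (p : MvPolynomial σ K) (o : SLPOperand K σ m) :
    o.castSucc.eval (Fin.snoc (α := fun _ => MvPolynomial σ K) v p) = o.eval v := by
  cases o with
  | const c => rfl
  | var x => rfl
  | reg i => exact Fin.snoc_castSucc (α := fun _ => MvPolynomial σ K) p v i

theorem SLPReach.exists_slp {K σ : Type*} [CommRing K] {m : ℕ} {U : Set (MvPolynomial σ K)}
    (h : SLPReach (slpInputs K σ) m U) : ∃ P : SLP K σ m, ∀ p ∈ U, P.Computes p := by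
  induction h with
  | refl =>
    refine ⟨.nil, ?_⟩
    rintro _ (⟨c, rfl⟩ | ⟨x, rfl⟩)
    · exact ⟨.const c, rfl⟩
    · exact ⟨.var x, rfl⟩
  | @step m U op x y h hx hy ih =>
    obtain ⟨P, hP⟩ := ih
    obtain ⟨a, ha⟩ := hP x hx
    obtain ⟨b, hb⟩ := hP y hy
    refine ⟨.snoc P op a b, ?_⟩
    rintro p (rfl | hp)
    · refine ⟨.reg (Fin.last m), ?_⟩
      rw [← ha, ← hb]
      exact Fin.snoc_last (α := fun _ => MvPolynomial σ K) _ _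
    · obtain ⟨o, rfl⟩ := hP p hp
      exact ⟨o.castSucc, o.eval_castSucc _ _⟩

theorem SLPComputable.hasSLPOfSize {K σ : Type*} [CommRing K] {N : ℕ} {p : MvPolynomial σ K}
    (h : SLPComputable (slpInputs K σ) N {p}) : HasSLPOfSize p N := by
  obtain ⟨m, hm, U, hU, hp⟩ := h
  obtain ⟨P, hP⟩ := hU.exists_slp
  exact ⟨m, hm, P, hP p (hp rfl)⟩

/-! ### Forward-mode differentiation -/

section ForwardMode

variable {K R σ : Type*} [CommRing K] [CommRing R] [Algebra K R] {r : ℕ} {S : Set R}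

/-- The values at `x` of a homomorphism and of the derivations `D j`. -/
def derivationJet (D : Fin r → Derivation K R R) (x : R) : Set R :=
  insert x (Set.range fun j => D j x)

/-- One operation gives the value; each derivative takes at most three, namely the two products and
the sum of the Leibniz rule. -/
theorem derivationJet_apply_op (D : Fin r → Derivation K R R) (op : SLPOp) {x y : R}
    (hx : derivationJet D x ⊆ S) (hy : derivationJet D y ⊆ S) :
    SLPComputable S (1 + 3 * r) (derivationJet D (op.apply x y)) := by
  have hx0 : x ∈ S := hx (Or.inl rfl)
  have hy0 : y ∈ S := hy (Or.inl rfl)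
  have hxD : ∀ j, D j x ∈ S := fun j => hx (Or.inr ⟨j, rfl⟩)
  have hyD : ∀ j, D j y ∈ S := fun j => hy (Or.inr ⟨j, rfl⟩)
  have hD : ∀ j, SLPComputable S 3 {D j (op.apply x y)} := by
    intro j
    cases op with
    | add =>
      simp only [SLPOp.apply, map_add]
      exact (SLPComputable.add (hxD j) (hyD j)).mono subset_rfl (by norm_num) subset_rfl
    | sub =>
      simp only [SLPOp.apply, map_sub]
      exact (SLPComputable.sub (hxD j) (hyD j)).mono subset_rfl (by norm_num) subset_rfl
    | mul =>
      simp only [SLPOp.apply, Derivation.leibniz, smul_eq_mul]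
      exact ((SLPComputable.mul hx0 (hyD j)).union (SLPComputable.mul hy0 (hxD j))).trans_right
        (.add (Or.inr (Or.inl rfl)) (Or.inr (Or.inr rfl)))
  refine ((SLPComputable.op op hx0 hy0).union (SLPComputable.iUnion hD)).mono subset_rfl ?_ ?_
  · simp [mul_comm]
  · rintro z (rfl | ⟨j, rfl⟩)
    · exact Or.inl rfl
    · exact Or.inr (Set.mem_iUnion.2 ⟨j, rfl⟩)

/-- Forward-mode automatic differentiation of a straight-line program whose variables are
substituted. -/
theorem SLP.computable_jets (φ : MvPolynomial σ K →ₐ[K] R) (D : Fin r → Derivation K R R)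
    (hK : Set.range (algebraMap K R) ⊆ S)
    (hX : ∀ x, derivationJet D (φ (MvPolynomial.X x)) ⊆ S) {m : ℕ} (P : SLP K σ m) :
    SLPComputable S (m * (1 + 3 * r))
      (⋃ o : SLPOperand K σ m, derivationJet D (φ (o.eval P.values))) := by
  have hC : ∀ c, derivationJet D (φ (MvPolynomial.C c)) ⊆ S := by
    intro c
    rw [← MvPolynomial.algebraMap_eq, AlgHom.commutes]
    rintro z (rfl | ⟨j, rfl⟩)
    · exact hK ⟨c, rfl⟩
    · exact hK ⟨0, by simp⟩
  induction P with
  | nil =>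
    refine .of_subset (Set.iUnion_subset fun o => ?_)
    cases o with
    | const c => exact hC c
    | var x => exact hX x
    | reg i => exact i.elim0
  | @snoc m P op a b ih =>
    rw [add_mul, one_mul]
    have hop := derivationJet_apply_op D op
      (S := S ∪ ⋃ o : SLPOperand K σ m, derivationJet D (φ (o.eval P.values)))
      (x := φ (a.eval P.values)) (y := φ (b.eval P.values))
      ((Set.subset_iUnion (fun o : SLPOperand K σ m => derivationJet D (φ (o.eval P.values)))
        a).trans Set.subset_union_right)
      ((Set.subset_iUnion (fun o : SLPOperand K σ m => derivationJet D (φ (o.eval P.values)))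
        b).trans Set.subset_union_right)
    refine (ih.trans hop).mono subset_rfl le_rfl (Set.iUnion_subset fun o => ?_)
    have hcast : ∀ o : SLPOperand K σ m,
        derivationJet D (φ (o.castSucc.eval (SLP.snoc P op a b).values)) ⊆
          ⋃ o : SLPOperand K σ m, derivationJet D (φ (o.eval P.values)) := by
      intro o
      rw [SLP.values, o.eval_castSucc]
      exact Set.subset_iUnion
        (fun o : SLPOperand K σ m => derivationJet D (φ (o.eval P.values))) o
    cases o with
    | const c => exact (hcast (.const c)).trans Set.subset_union_left
    | var x => exact (hcast (.var x)).trans Set.subset_union_left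
    | reg i =>
      induction i using Fin.lastCases with
      | cast i => exact (hcast (.reg i)).trans Set.subset_union_left
      | last =>
        refine subset_trans (le_of_eq ?_) Set.subset_union_right
        congr 1
        simp only [SLPOperand.eval, SLP.values, Fin.snoc_last]
        cases op <;> simp [SLPOp.apply]

end ForwardMode

/-! ### Entries and minors of the Jacobian matrix -/

section Jacobian

variable {n : ℕ}

/-- These derivatives are constants, so the jets of the substituted variables cost no more than the
linear forms themselves. -/
theorem pderiv_changeCoords_X (A : Matrix.GeneralLinearGroup (Fin n) ℚ) (x j : Fin n) :
    MvPolynomial.pderiv j (changeCoords A (MvPolynomial.X x)) =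
      MvPolynomial.C ((A : Matrix (Fin n) (Fin n) ℚ) x j) := by
  simp [changeCoords, Derivation.leibniz, MvPolynomial.pderiv_X, Pi.single_apply]

/-- The partial derivatives of `f(A X)` with respect to `r` of the variables. -/
theorem SLPComputable.pderiv_changeCoords {L r : ℕ} (A : Matrix.GeneralLinearGroup (Fin n) ℚ)
    {f : MvPolynomial (Fin n) ℚ} (hf : HasSLPOfSize f L) (J : Fin r → Fin n) :
    SLPComputable (slpInputs ℚ (Fin n)) (2 * n ^ 2 + L * (1 + 3 * r))
      (Set.range fun j => MvPolynomial.pderiv (J j) (changeCoords A f)) := by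
  obtain ⟨m, hm, P, o, rfl⟩ := hf
  have hC : ∀ c, MvPolynomial.C c ∈ slpInputs ℚ (Fin n) := fun c => Or.inl ⟨c, rfl⟩
  have hlin : ∀ x : Fin n, SLPComputable (slpInputs ℚ (Fin n)) (2 * n)
      {changeCoords A (MvPolynomial.X x)} := fun x => by
    have := SLPComputable.sum_mul (S := slpInputs ℚ (Fin n))
      (g := fun j => MvPolynomial.C ((A : Matrix (Fin n) (Fin n) ℚ) x j))
      (g' := fun j => MvPolynomial.X j) (by simpa using hC 0) (fun j => hC _)
      (fun j => Or.inr ⟨j, rfl⟩)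
    rw [Fintype.card_fin] at this
    simpa [changeCoords] using this
  -- The derivations act after the substitution, so no separate chain rule is needed.
  have hjet := P.computable_jets
    (S := slpInputs ℚ (Fin n) ∪ ⋃ x : Fin n, {changeCoords A (MvPolynomial.X x)})
    (MvPolynomial.bind₁ fun i => ∑ j : Fin n,
      MvPolynomial.C ((A : Matrix (Fin n) (Fin n) ℚ) i j) * MvPolynomial.X j)
    (fun j => MvPolynomial.pderiv (J j))
    (by rintro _ ⟨c, rfl⟩; exact Or.inl (hC c))
    (by
      rintro x z (rfl | ⟨j, rfl⟩)
      · exact Or.inr (Set.mem_iUnion.2 ⟨x, rfl⟩)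
      · exact Or.inl (by
          have := hC ((A : Matrix (Fin n) (Fin n) ℚ) x (J j))
          rwa [← pderiv_changeCoords_X] at this))
  refine ((SLPComputable.iUnion hlin).trans_right hjet).mono subset_rfl ?_ ?_
  · rw [Fintype.card_fin]
    have := Nat.mul_le_mul_right (1 + 3 * r) hm
    nlinarith
  · rintro _ ⟨j, rfl⟩
    exact Set.mem_iUnion.2 ⟨o, Or.inr ⟨j, rfl⟩⟩

/-- A minor of size `r` of the Jacobian matrix has a straight-line program of size
`O(r ^ 2 * L + r * n ^ 2 + r ^ 4)`. -/
theorem hasSLPOfSize_minor {s L k r : ℕ} {f : MvPolynomial (Fin n) ℚ}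
    {F : Fin s → MvPolynomial (Fin n) ℚ} (A : Matrix.GeneralLinearGroup (Fin n) ℚ)
    (hf : HasSLPOfSize f L) (hF : ∀ a, HasSLPOfSize (F a) L) {q : MvPolynomial (Fin n) ℚ}
    (hq : IsMinor (truncJacobian (Fin.cons (changeCoords A f) (fun a => changeCoords A (F a)) :
      Fin (s + 1) → MvPolynomial (Fin n) ℚ) k) r q) :
    HasSLPOfSize q (r * (2 * n ^ 2 + L * (1 + 3 * r)) + (5 * r ^ 4 + 1)) := by
  obtain ⟨rows, cols, rfl⟩ := hq
  have hrow : ∀ a : Fin (s + 1), ∃ g, HasSLPOfSize g L ∧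
      (Fin.cons (changeCoords A f) (fun a => changeCoords A (F a)) :
        Fin (s + 1) → MvPolynomial (Fin n) ℚ) a = changeCoords A g := by
    intro a
    cases a using Fin.cases with
    | zero => exact ⟨f, hf, rfl⟩
    | succ a => exact ⟨F a, hF a, rfl⟩
  choose g hg hg' using hrow
  have hentries := SLPComputable.iUnion fun a : Fin r =>
    SLPComputable.pderiv_changeCoords A (hg (rows a)) fun j : Fin r => (cols j).1
  rw [Fintype.card_fin] at hentries
  refine (hentries.trans_right (SLPComputable.det ?_ ?_)).hasSLPOfSize
  · rintro _ ⟨c, rfl⟩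
    exact Or.inl (Or.inl ⟨c, rfl⟩)
  · rintro _ ⟨⟨a, j⟩, rfl⟩
    refine Or.inr (Set.mem_iUnion.2 ⟨a, j, ?_⟩)
    simp [truncJacobian, hg']

end Jacobian

/-! ### Nonnegativity of ω and the final estimate -/

/-- With all variables equal to t, the entry becomes m t². This is not constant in t, and it is even
and nonzero at 1, unlike a variable. -/
theorem genericMatMulEntry_ne_operand {K : Type*} [CommRing K] [CharZero K] {m : ℕ} (hm : 1 ≤ m)
    (i j : Fin m) (P : SLP K ((Fin m × Fin m) ⊕ (Fin m × Fin m)) 0) :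
    ¬ P.Computes (genericMatMulEntry K m i j) := by
  have hm0 : (m : K) ≠ 0 := Nat.cast_ne_zero.2 (by omega)
  have heval : ∀ t : K, MvPolynomial.eval (fun _ => t) (genericMatMulEntry K m i j) =
      m * (t * t) := fun t => by simp [genericMatMulEntry]
  rintro ⟨o, ho⟩
  cases o with
  | const c =>
    have h0 := heval 0
    have h1 := heval 1
    rw [← ho] at h0 h1
    simp [SLPOperand.eval] at h0 h1
    exact hm0 (by rw [← h1, h0])
  | var x =>
    have h1 := heval 1
    have h2 := heval (-1)
    rw [← ho] at h1 h2
    simp [SLPOperand.eval] at h1 h2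
    have h3 : (2 : K) = 0 := by linear_combination h1 - h2
    exact two_ne_zero h3
  | reg l => exact l.elim0

theorem matMulExponent_nonneg (K : Type*) [CommRing K] [CharZero K] : 0 ≤ matMulExponent K := by
  -- This also covers the empty set, whose `sInf` is 0 by convention, so no admissible τ has to be
  -- exhibited.
  refine Real.sInf_nonneg ?_
  rintro τ ⟨C, hC⟩
  by_contra! hτ
  -- For τ < 0 the size bound tends to 0, so for large m the program would have no instructions.
  have hlim : Filter.Tendsto (fun m : ℕ => C * (m : ℝ) ^ τ) Filter.atTop (nhds 0) := by
    have h := (tendsto_rpow_neg_atTop (neg_pos.2 hτ)).comp tendsto_natCast_atTop_atTop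
    simpa using h.const_mul C
  obtain ⟨m, hm, hm1⟩ := ((hlim.eventually (gt_mem_nhds one_pos)).and
    (Filter.eventually_ge_atTop 1)).exists
  obtain ⟨N, P, hP, hN⟩ := hC m hm1
  have hN0 : N = 0 := by
    have : (N : ℝ) < 1 := hN.trans_lt hm
    exact Nat.lt_one_iff.1 (by exact_mod_cast this)
  subst hN0
  exact genericMatMulEntry_ne_operand hm1 ⟨0, hm1⟩ ⟨0, hm1⟩ P (hP _ _)

theorem mainTheorem11 :
    ∃ (C : ℝ) (e : ℕ), ∀ (n s d L i : ℕ) (f : MvPolynomial (Fin n) ℚ)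
      (F : Fin s → MvPolynomial (Fin n) ℚ) (A : Matrix.GeneralLinearGroup (Fin n) ℚ),
      d ≤ n →
      HasSLPOfSize f L →
      (∀ a : Fin s, HasSLPOfSize (F a) L) →
      ∀ q : MvPolynomial (Fin n) ℚ,
        IsMinor
          (truncJacobian
            (Fin.cons (changeCoords A f) (fun a => changeCoords A (F a)) :
              Fin (s + 1) → MvPolynomial (Fin n) ℚ) (i + 1))
          (n - d + 1) q →
        ∃ N : ℕ, HasSLPOfSize q N ∧
          (N : ℝ) ≤ C *
            (((n - d + 1 : ℕ) : ℝ) ^ (matMulExponent ℚ / 2 + 2) * ((L : ℝ) + (n : ℝ) ^ 2)) *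
            Real.log (2 +
              ((n - d + 1 : ℕ) : ℝ) ^ (matMulExponent ℚ / 2 + 2) * ((L : ℝ) + (n : ℝ) ^ 2)) ^ e := by
  -- The terms are bounded by 2r²n², 4r²L and 6r²n², so 13 is a generous constant; e = 0 removes the
  -- logarithm.
  refine ⟨13, 0, fun n s d L i f F A _ hf hF q hq => ⟨_, hasSLPOfSize_minor A hf hF hq, ?_⟩⟩
  -- The columns of the minor are distinct variables among n.
  have hrn : n - d + 1 ≤ n := by
    obtain ⟨_, cols, _⟩ := hq
    have := Fintype.card_le_of_injective (fun j => (cols j).1)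
      (Subtype.val_injective.comp cols.injective)
    simpa using this
  have hr1 : (1 : ℝ) ≤ ((n - d + 1 : ℕ) : ℝ) := by exact_mod_cast Nat.le_add_left 1 (n - d)
  generalize n - d + 1 = r at *
  have hrn' : (r : ℝ) ≤ n := by exact_mod_cast hrn
  have hpow : (r : ℝ) ^ 2 ≤ (r : ℝ) ^ (matMulExponent ℚ / 2 + 2) := by
    rw [← Real.rpow_natCast]
    refine Real.rpow_le_rpow_of_exponent_le hr1 ?_
    have := matMulExponent_nonneg ℚ
    push_cast
    linarith
  have hLn : (0 : ℝ) ≤ (L : ℝ) + (n : ℝ) ^ 2 := by positivity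
  have hmul := mul_le_mul_of_nonneg_right hpow hLn
  have hL : (0 : ℝ) ≤ L := L.cast_nonneg
  have hr2 : (r : ℝ) ≤ (r : ℝ) ^ 2 := by nlinarith
  have hsq : (r : ℝ) ^ 2 ≤ (n : ℝ) ^ 2 := pow_le_pow_left₀ (by linarith) hrn' 2
  have h4 : (r : ℝ) ^ 4 ≤ (r : ℝ) ^ 2 * (n : ℝ) ^ 2 := by
    calc (r : ℝ) ^ 4 = (r : ℝ) ^ 2 * (r : ℝ) ^ 2 := by ring
      _ ≤ _ := mul_le_mul_of_nonneg_left hsq (by positivity)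
  have h1 : (1 : ℝ) ≤ (r : ℝ) ^ 4 := one_le_pow₀ hr1
  have hn : (r : ℝ) * (n : ℝ) ^ 2 ≤ (r : ℝ) ^ 2 * (n : ℝ) ^ 2 :=
    mul_le_mul_of_nonneg_right hr2 (by positivity)
  have hrL : (r : ℝ) * L ≤ (r : ℝ) ^ 2 * L := mul_le_mul_of_nonneg_right hr2 hL
  have hL2 : (0 : ℝ) ≤ (r : ℝ) ^ 2 * L := by positivity
  have hn2 : (0 : ℝ) ≤ (r : ℝ) ^ 2 * (n : ℝ) ^ 2 := by positivity
  rw [pow_zero, mul_one]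
  push_cast
  nlinarith
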